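/- Let $H_1,\dots,H_S$ be candidate modulation formats. Each $H_i$ has $M_i$ constellation symbols $I^{1,(i)},\dots,I^{M_i,(i)}\in\mathbb C$ and is either $M_i$-PSK ($M_i\ge 2$; symbols $e^{j(2\pi m/M_i+\varphi_i)}$, $m=0,\dots,M_i-1$, with a fixed rotation $\varphi_i$) or $M_i$-QAM ($M_i$ distinct points of unit average power whose moduli are not all equal). Distinct candidates differ in their family (PSK or QAM) or in their number of symbols. Under hypothesis $H_i$ the received samples are $r_n=a\,e^{j\theta}I_n+w_n$, $n=1,\dots,N$, where the $I_n$ are i.i.d. uniform on the symbols of $H_i$, the $w_n$ are i.i.d. circularly symmetric complex Gaussian $\mathcal{CN}(0,N_0)$, and symbols and noise are independent. The amplitude, noise power and phase $\mathbf u=(a,N_0,\theta)$ are unknown and constant over the observation. They are confined to the compact box $\mathbb U_i=[0,A^U]\times[0,N^U]\times[0,\theta_i^U]$, where $\theta_i^U=2\pi/M_i$ for PSK and $\theta_i^U=\pi/2$ for QAM, and the true value $\mathbf u_i^*$ under $H_i$ lies in the interior of $\mathbb U_i$. Put $$p(r\mid H_i,\mathbf u)=\frac1{M_i}\sum_{m=1}^{M_i}\frac1{\pi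 N_0}\exp\Big(-\frac{|r-ae^{j\theta}I^{m,(i)}|^2}{N_0}\Big),\qquad \Lambda_i(\mathbf r,\mathbf u)=-\frac1N\sum_{n=1}^N\log p(r_n\mid H_i,\mathbf u),$$ with $p(r\mid H_i,\mathbf u)=0$ on the face $N_0=0$, and let $\hat{\mathbf u}_i=\hat{\mathbf u}_i(\mathbf r)\in\mathbb U_i$ be a maximum likelihood estimate, i.e. a maximizer of $\mathbf u\mapsto\prod_{n=1}^N p(r_n\mid H_i,\mathbf u)$ over $\mathbb U_i$ (an arbitrary point of $\mathbb U_i$ for observations $\mathbf r$ for which there is no maximizer). The HLRT classifier decides $\hat i=\arg\min_{i}\Lambda_i(\mathbf r,\hat{\mathbf u}_i)$. Its average probability of error is $$P_e=\frac1S\sum_{i=1}^S P_e^i,\qquad P_e^i=1-P\big(\Lambda_i(\mathbf r,\hat{\mathbf u}_i)<\Lambda_j(\mathbf r,\hat{\mathbf u}_j)\ \text{for all } j\ne i\,\big|\,H_i,\mathbf u_i^*\big).$$ Then, for every choice of the true parameters $\mathbf u_i^*$ (hence for every SNR), $$\lim_{N\to\infty}P_e=0 .$$ -/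

import Mathlib

open MeasureTheory ProbabilityTheory Filter Topology

namespace HLRT

noncomputable section

/-- The two families of digital amplitude-phase modulations. -/
inductive Family where
  | psk
  | qam

/-- A modulation format: an `M`-PSK constellation (`M ≥ 2`), possibly rotated by a fixed phase
`φ`, or an `M`-QAM constellation `b_m e^{jθ_m}`, `m = 0, …, M - 1`, that is, `M` distinct complex
points with unit average power whose amplitudes `b_m` are not all equal. -/
inductive Modulation where
  | psk (M : ℕ) (hM : 2 ≤ M) (φ : ℝ)
  | qam (M : ℕ) (pt : Fin M → ℂ) (distinct : Function.Injective pt)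
      (unitPower : (1 / (M : ℝ)) * ∑ m, ‖pt m‖ ^ 2 = 1)
      (amplitudes : ∃ m m', ‖pt m‖ ≠ ‖pt m'‖)

/-- Whether the format is a PSK or a QAM format. -/
def Modulation.family : Modulation → Family
  | .psk .. => .psk
  | .qam .. => .qam

/-- The number `M` of constellation symbols. -/
def Modulation.order : Modulation → ℕ
  | .psk M _ _ => M
  | .qam M _ _ _ _ => M

/-- The constellation symbols. -/
def Modulation.symbol : (H : Modulation) → Fin H.order → ℂ
  | .psk M _ φ => fun m => Complex.exp (((2 * Real.pi * (m : ℝ) / (M : ℝ) + φ : ℝ) : ℂ) * Complex.I)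
  | .qam _ pt _ _ _ => pt

/-- The upper end of the search interval for the phase: `2π/M` for `M`-PSK, `π/2` for QAM. -/
def Modulation.phaseMax : Modulation → ℝ
  | .psk M _ _ => 2 * Real.pi / (M : ℝ)
  | .qam .. => Real.pi / 2

/-- The unknown parameter `(a, N₀, θ)`: amplitude, noise power, phase. -/
abbrev Param : Type := ℝ × ℝ × ℝ

/-- Amplitude `a`. -/
abbrev Param.amp (u : Param) : ℝ := u.1

/-- Noise power `N₀`. -/
abbrev Param.noise (u : Param) : ℝ := u.2.1

/-- Phase `θ`. -/
abbrev Param.phase (u : Param) : ℝ := u.2.2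

/-- The complex channel gain `a e^{jθ}`. -/
def Param.gain (u : Param) : ℂ := (u.amp : ℂ) * Complex.exp ((u.phase : ℂ) * Complex.I)

/-- The compact parameter box `[0, A] × [0, B] × [0, θ_max]` of a format. -/
def box (A B : ℝ) (H : Modulation) : Set Param :=
  Set.Icc 0 A ×ˢ Set.Icc 0 B ×ˢ Set.Icc 0 H.phaseMax

/-! ### The true distribution of the observations -/

/-- The circularly symmetric complex Gaussian law `CN(0, N₀)`: independent centered Gaussian real
and imaginary parts of variance `N₀ / 2`. -/
def complexGaussian (N₀ : ℝ) : Measure ℂ :=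
  ((gaussianReal 0 (N₀ / 2).toNNReal).prod (gaussianReal 0 (N₀ / 2).toNNReal)).map
    (fun x : ℝ × ℝ => (x.1 : ℂ) + (x.2 : ℂ) * Complex.I)

/-- The joint law of `N` independent pairs (index of the transmitted symbol, noise sample): the
symbol is uniform on the constellation and independent of the noise, which is `CN(0, N₀)`. -/
def sourceLaw (H : Modulation) (N₀ : ℝ) (N : ℕ) : Measure (Fin N → Fin H.order × ℂ) :=
  Measure.pi fun _ => (uniformOn (Set.univ : Set (Fin H.order))).prod (complexGaussian N₀)

/-- The received samples `r_n = a e^{jθ} I_n + w_n`. -/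
def received (H : Modulation) (u : Param) {N : ℕ} (x : Fin N → Fin H.order × ℂ) : Fin N → ℂ :=
  fun n => u.gain * H.symbol (x n).1 + (x n).2

/-- The law of the observation vector `r` when the format is `H` and the parameter is `u`. -/
def observationLaw (H : Modulation) (u : Param) (N : ℕ) : Measure (Fin N → ℂ) :=
  (sourceLaw H u.noise N).map (received H u)

/-! ### The classifier -/

/-- The likelihood `p(r_n | H, u)` of one sample, averaged over the equiprobable symbols:
`(1/M) ∑ₘ (π N₀)⁻¹ exp (-|r_n - a e^{jθ} I^m|² / N₀)`. On the face `N₀ = 0` its value is `0`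
(because `0⁻¹ = 0`), which is the limit as `N₀ → 0` at every `r_n` other than `a e^{jθ} I^m`. -/
def sampleLikelihood (H : Modulation) (u : Param) (r : ℂ) : ℝ :=
  (1 / (H.order : ℝ)) * ∑ m, (Real.pi * u.noise)⁻¹ *
    Real.exp (-(‖r - u.gain * H.symbol m‖ ^ 2 / u.noise))

/-- The likelihood `p(r | H, u) = ∏ₙ p(r_n | H, u)`. -/
def likelihood (H : Modulation) (u : Param) {N : ℕ} (r : Fin N → ℂ) : ℝ :=
  ∏ n, sampleLikelihood H u (r n)

/-- `est` is a maximum likelihood estimator of `(a, N₀, θ)` under `H` over the box: its value is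
always in the box, and maximizes the likelihood over the box for all observations `r` for which
a maximizer exists. (For `N ≥ 2` the exceptional `r` form a null set. For `N = 1` they do not: the
likelihood is unbounded as `N₀ → 0` if `r` is on a scaled and rotated constellation.) -/
def IsMLEstimator (A B : ℝ) (H : Modulation) {N : ℕ} (est : (Fin N → ℂ) → Param) : Prop :=
  ∀ r : Fin N → ℂ, est r ∈ box A B H ∧
    ((∃ u ∈ box A B H, IsMaxOn (fun u => likelihood H u r) (box A B H) u) →
      IsMaxOn (fun u => likelihood H u r) (box A B H) (est r))

/-- The test statistic `Λ(r, u) = -(1/N) ∑ₙ log p(r_n | H, u)`. -/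
def testStat (H : Modulation) (u : Param) {N : ℕ} (r : Fin N → ℂ) : ℝ :=
  -(1 / (N : ℝ)) * ∑ n, Real.log (sampleLikelihood H u (r n))

/-- The probability of error `1 - P(Λ_i < Λ_j for all j ≠ i | H_i)` under the hypothesis `H i`
with true parameter `u`, for the classifier that picks the smallest `Λ_j(r, est_j(r))`; it is
written as the probability of the complementary event. -/
def errorProb {S : ℕ} (H : Fin S → Modulation) {N : ℕ} (est : Fin S → (Fin N → ℂ) → Param)
    (i : Fin S) (u : Param) : ℝ :=
  (observationLaw (H i) u N).real
    {r | ¬ ∀ j, j ≠ i → testStat (H i) (est i r) r < testStat (H j) (est j r) r}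

/-- The average probability of error `P_e = (1/S) ∑ᵢ P_eⁱ`. -/
def avgErrorProb {S : ℕ} (H : Fin S → Modulation) {N : ℕ} (est : Fin S → (Fin N → ℂ) → Param)
    (u : Fin S → Param) : ℝ :=
  (1 / (S : ℝ)) * ∑ i, errorProb H est i (u i)

end

end HLRT

/-! This is Wald's consistency argument. Under the true format the samples are i.i.d. from a
Gaussian mixture with density `f`. Every candidate likelihood is again such a mixture `q`, with
centers `g * I m` and variance `N₀`. If `q ≠ f`, then `log f - log q` has positive mean under `f`
(Gibbs' inequality, `integral_log_gaussMix_sub_pos`), so by Chebyshev's inequality the true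
parameter beats this one `q` with probability tending to one.

A wrong format never produces `f`. The tails of a mixture determine its variance. Once the variances
agree, linear independence of exponential characters determines the mass at each center
(`card_filter_eq_of_gaussMix_eq`). The set of centers then reveals the number of symbols, and
whether their moduli all agree, hence the family (`exists_gaussMix_ne`).

To beat all wrong parameters at once, the parameter set is split at a small noise power `δ`. Where
`N₀ ≥ δ`, compactness and local uniform continuity of `log q` suffice
(`tendsto_measure_exists_le_of_isCompact`). As `N₀ → 0` the likelihood may be unbounded. However,
with high probability at least half of the samples stay away from the finitely many centers, and
their penalty of order `1 / N₀` outweighs the gain `log (1 / N₀)`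
(`exists_tendsto_measure_exists_le_of_variance_lt`).

The small-noise estimate also shows that maximizers exist with probability tending to one. The
estimate for the true format then does at least as well as the true parameter, which beats every
parameter of the wrong format. -/

namespace HLRT

/-! ### Equal-weight mixtures of circular Gaussian densities -/

/-- The density of the equal-weight mixture of the circular Gaussian laws `CN(c m, s)`. -/
noncomputable def gaussMix {M : ℕ} (c : Fin M → ℂ) (s : ℝ) (r : ℂ) : ℝ :=
  (1 / (M : ℝ)) * ∑ m, (Real.pi * s)⁻¹ * Real.exp (-(‖r - c m‖ ^ 2 / s))

lemma sampleLikelihood_eq (H : Modulation) (u : Param) (r : ℂ) :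
    sampleLikelihood H u r = gaussMix (fun m => u.gain * H.symbol m) u.noise r := rfl

section

variable {M : ℕ} (c : Fin M → ℂ) {s : ℝ} (r : ℂ)

@[simp]
lemma gaussMix_zero : gaussMix c 0 r = 0 := by simp [gaussMix]

lemma gaussMix_pos (hM : 0 < M) (hs : 0 < s) : 0 < gaussMix c s r := by
  have : Nonempty (Fin M) := ⟨⟨0, hM⟩⟩
  have hM' : (0 : ℝ) < M := by exact_mod_cast hM
  unfold gaussMix
  refine mul_pos (by positivity) (Finset.sum_pos (fun m _ => ?_) Finset.univ_nonempty)
  positivity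

lemma gaussMix_le (hs : 0 < s) {x : ℝ} (hx : ∀ m, x ≤ ‖r - c m‖ ^ 2) :
    gaussMix c s r ≤ (Real.pi * s)⁻¹ * Real.exp (-(x / s)) := by
  unfold gaussMix
  rcases Nat.eq_zero_or_pos M with rfl | hM
  · simp; positivity
  have hM' : (0 : ℝ) < M := by exact_mod_cast hM
  calc (1 / (M : ℝ)) * ∑ m, (Real.pi * s)⁻¹ * Real.exp (-(‖r - c m‖ ^ 2 / s))
      ≤ (1 / (M : ℝ)) * ∑ _m : Fin M, (Real.pi * s)⁻¹ * Real.exp (-(x / s)) := by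
        gcongr with m
        exact hx m
    _ = _ := by simp; field_simp

lemma le_gaussMix (hM : 0 < M) (hs : 0 < s) {x : ℝ} (hx : ∀ m, ‖r - c m‖ ^ 2 ≤ x) :
    (Real.pi * s)⁻¹ * Real.exp (-(x / s)) ≤ gaussMix c s r := by
  unfold gaussMix
  have hM' : (0 : ℝ) < M := by exact_mod_cast hM
  calc (Real.pi * s)⁻¹ * Real.exp (-(x / s))
      = (1 / (M : ℝ)) * ∑ _m : Fin M, (Real.pi * s)⁻¹ * Real.exp (-(x / s)) := by
        simp; field_simp
    _ ≤ _ := by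
        gcongr with m
        exact hx m

lemma continuous_gaussMix (s : ℝ) : Continuous (gaussMix c s) := by
  unfold gaussMix
  fun_prop

lemma log_inv_mul_exp {t : ℝ} (ht : 0 < t) (y : ℝ) :
    Real.log (t⁻¹ * Real.exp y) = -Real.log t + y := by
  rw [Real.log_mul (by positivity) (Real.exp_ne_zero _), Real.log_inv, Real.log_exp]

lemma log_gaussMix_le (hM : 0 < M) (hs : 0 < s) {x : ℝ} (hx : ∀ m, x ≤ ‖r - c m‖ ^ 2) :
    Real.log (gaussMix c s r) ≤ -Real.log (Real.pi * s) - x / s := by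
  have := Real.log_le_log (gaussMix_pos c r hM hs) (gaussMix_le c r hs hx)
  rw [log_inv_mul_exp (by positivity)] at this
  linarith

/-- Quadratic growth makes log-densities square integrable under any Gaussian mixture, as the law of
large numbers below requires. -/
lemma abs_log_gaussMix_le (hM : 0 < M) (hs : 0 < s) :
    ∃ C : ℝ, 0 ≤ C ∧ ∀ r, |Real.log (gaussMix c s r)| ≤ C * (1 + ‖r‖ ^ 2) := by
  set R : ℝ := ∑ m, ‖c m‖ ^ 2
  have hR : 0 ≤ R := Finset.sum_nonneg fun m _ => by positivity
  refine ⟨|Real.log (Real.pi * s)| + (2 + 2 * R) / s, by positivity, fun r => ?_⟩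
  have h1 : Real.log (gaussMix c s r) ≤ -Real.log (Real.pi * s) - 0 / s :=
    log_gaussMix_le c r hM hs fun m => by positivity
  have h2 := Real.log_le_log (by positivity) (le_gaussMix c r hM hs (x := 2 * ‖r‖ ^ 2 + 2 * R)
    fun m => by
      have h3 : ‖c m‖ ^ 2 ≤ R :=
        Finset.single_le_sum (f := fun m => ‖c m‖ ^ 2) (fun m _ => by positivity)
          (Finset.mem_univ m)
      have h4 := norm_sub_le r (c m)
      nlinarith [sq_nonneg (‖r‖ - ‖c m‖), norm_nonneg (r - c m), norm_nonneg r, norm_nonneg (c m)])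
  rw [log_inv_mul_exp (by positivity)] at h2
  have h5 : (2 * ‖r‖ ^ 2 + 2 * R) / s ≤ (2 + 2 * R) / s * (1 + ‖r‖ ^ 2) := by
    rw [div_mul_eq_mul_div]
    gcongr
    nlinarith [sq_nonneg ‖r‖, mul_nonneg hR (sq_nonneg ‖r‖)]
  have h6 : |Real.log (Real.pi * s)| ≤ |Real.log (Real.pi * s)| * (1 + ‖r‖ ^ 2) := by
    nlinarith [sq_nonneg ‖r‖, mul_nonneg (abs_nonneg (Real.log (Real.pi * s))) (sq_nonneg ‖r‖)]
  have h7 := le_abs_self (Real.log (Real.pi * s))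
  have h8 := neg_abs_le (Real.log (Real.pi * s))
  have h9 : 0 ≤ (2 + 2 * R) / s * (1 + ‖r‖ ^ 2) := by positivity
  rw [abs_le]
  constructor <;> simp only [zero_div] at * <;> linarith

end

/-- Locally uniform comparison of the mixtures whose centers are the multiples of a fixed
constellation: the log-density depends continuously on gain and variance, up to a factor
quadratic in the observation. -/
lemma eventually_log_gaussMix_le {M : ℕ} (hM : 0 < M) (I : Fin M → ℂ) (g₀ : ℂ) {s₀ : ℝ}
    (hs₀ : 0 < s₀) {ε : ℝ} (hε : 0 < ε) :
    ∀ᶠ p : ℂ × ℝ in 𝓝 (g₀, s₀), ∀ r, Real.log (gaussMix (fun m => p.1 * I m) p.2 r) ≤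
      Real.log (gaussMix (fun m => g₀ * I m) s₀ r) + ε * (1 + ‖r‖ ^ 2) := by
  -- A single Gaussian log-density is a quadratic polynomial in `r`. The terms of `Ω` measure the
  -- change of its normalization, quadratic, linear and constant coefficients. Since `2‖r‖ ≤ 1 + ‖r‖
  -- ^ 2`, the log-density changes by at most `Ω * (1 + ‖r‖ ^ 2)`; the bound on each component then
  -- passes to the average.
  let Ω : Fin M → ℂ × ℝ → ℝ := fun m p =>
    |Real.log (Real.pi * p.2) - Real.log (Real.pi * s₀)| + |p.2⁻¹ - s₀⁻¹|
      + ‖(p.2⁻¹ : ℂ) * (p.1 * I m) - (s₀⁻¹ : ℂ) * (g₀ * I m)‖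
      + |‖p.1 * I m‖ ^ 2 / p.2 - ‖g₀ * I m‖ ^ 2 / s₀|
  have hΩ : ∀ m, ∀ᶠ p in 𝓝 (g₀, s₀), Ω m p < ε := by
    intro m
    have h1 : ContinuousAt (Ω m) (g₀, s₀) := by
      have hπ : Real.pi * s₀ ≠ 0 := by positivity
      have hs : s₀ ≠ 0 := hs₀.ne'
      have hsc : (s₀ : ℂ) ≠ 0 := by exact_mod_cast hs
      have a1 : ContinuousAt (fun p : ℂ × ℝ => Real.log (Real.pi * p.2)) (g₀, s₀) :=
        ContinuousAt.log (by fun_prop) hπ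
      have a2 : ContinuousAt (fun p : ℂ × ℝ => p.2⁻¹) (g₀, s₀) :=
        ContinuousAt.inv₀ (by fun_prop) hs
      have a3 : ContinuousAt (fun p : ℂ × ℝ => (p.2⁻¹ : ℂ)) (g₀, s₀) :=
        ContinuousAt.inv₀ (by fun_prop) hsc
      have a4 : ContinuousAt (fun p : ℂ × ℝ => ‖p.1 * I m‖ ^ 2 / p.2) (g₀, s₀) :=
        ContinuousAt.div (by fun_prop) (by fun_prop) hs
      have a5 : ContinuousAt (fun p : ℂ × ℝ => (p.2⁻¹ : ℂ) * (p.1 * I m)) (g₀, s₀) :=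
        a3.mul (by fun_prop)
      exact (((a1.sub continuousAt_const).abs.add (a2.sub continuousAt_const).abs).add
        (a5.sub continuousAt_const).norm).add (a4.sub continuousAt_const).abs
    have h2 : Ω m (g₀, s₀) < ε := by simpa [Ω] using hε
    exact h1.eventually_lt continuousAt_const h2
  have hpos : ∀ᶠ p : ℂ × ℝ in 𝓝 (g₀, s₀), 0 < p.2 :=
    continuousAt_const.eventually_lt (f := fun _ => (0 : ℝ)) continuous_snd.continuousAt hs₀
  filter_upwards [eventually_all.2 hΩ, hpos] with p hp hp0 r
  obtain ⟨g, s⟩ := p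
  simp only at hp hp0 ⊢
  have key : ∀ m, (Real.pi * s)⁻¹ * Real.exp (-(‖r - g * I m‖ ^ 2 / s)) ≤
      Real.exp (ε * (1 + ‖r‖ ^ 2)) *
        ((Real.pi * s₀)⁻¹ * Real.exp (-(‖r - g₀ * I m‖ ^ 2 / s₀))) := by
    intro m
    rw [← Real.log_le_log_iff (by positivity) (by positivity),
      Real.log_mul (x := Real.exp _) (by positivity) (by positivity), Real.log_exp,
      log_inv_mul_exp (by positivity), log_inv_mul_exp (by positivity)]
    have hm := hp m
    have e : ∀ (c : ℂ) (t : ℝ), ‖r - c‖ ^ 2 / t =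
        ‖r‖ ^ 2 * t⁻¹ - 2 * inner ℝ r ((t⁻¹ : ℂ) * c) + ‖c‖ ^ 2 / t := by
      intro c t
      have : (t⁻¹ : ℂ) * c = (t⁻¹ : ℝ) • c := by simp
      rw [@norm_sub_sq_real, this, real_inner_smul_right]
      ring
    rw [e, e]
    have hin : inner ℝ r ((s⁻¹ : ℂ) * (g * I m)) - inner ℝ r ((s₀⁻¹ : ℂ) * (g₀ * I m)) ≤
        ‖r‖ * ‖(s⁻¹ : ℂ) * (g * I m) - (s₀⁻¹ : ℂ) * (g₀ * I m)‖ := by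
      rw [← inner_sub_right]
      exact real_inner_le_norm _ _
    simp only [Ω] at hm
    set A := |Real.log (Real.pi * s) - Real.log (Real.pi * s₀)|
    set B := |s⁻¹ - s₀⁻¹|
    set D := ‖(s⁻¹ : ℂ) * (g * I m) - (s₀⁻¹ : ℂ) * (g₀ * I m)‖
    set F := |‖g * I m‖ ^ 2 / s - ‖g₀ * I m‖ ^ 2 / s₀|
    have hA : -A ≤ _ := neg_abs_le _
    have hB : -B ≤ _ := neg_abs_le _
    have hF : -F ≤ _ := neg_abs_le _
    have hA0 : 0 ≤ A := abs_nonneg _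
    have hB0 : 0 ≤ B := abs_nonneg _
    have hD0 : 0 ≤ D := norm_nonneg _
    have hF0 : 0 ≤ F := abs_nonneg _
    have hB' : -(‖r‖ ^ 2 * B) ≤ ‖r‖ ^ 2 * s⁻¹ - ‖r‖ ^ 2 * s₀⁻¹ := by
      nlinarith [mul_le_mul_of_nonneg_left hB (sq_nonneg ‖r‖)]
    have hD' : 2 * (‖r‖ * D) ≤ (1 + ‖r‖ ^ 2) * D := by
      nlinarith [mul_nonneg hD0 (sq_nonneg (‖r‖ - 1))]
    have htot : (1 + ‖r‖ ^ 2) * (A + B + D + F) ≤ (1 + ‖r‖ ^ 2) * ε := by gcongr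
    nlinarith [mul_nonneg hA0 (sq_nonneg ‖r‖), mul_nonneg hF0 (sq_nonneg ‖r‖)]
  have hle : gaussMix (fun m => g * I m) s r ≤
      Real.exp (ε * (1 + ‖r‖ ^ 2)) * gaussMix (fun m => g₀ * I m) s₀ r := by
    unfold gaussMix
    rw [mul_left_comm, Finset.mul_sum Finset.univ _ (Real.exp _)]
    exact mul_le_mul_of_nonneg_left (Finset.sum_le_sum fun m _ => key m) (by positivity)
  have := Real.log_le_log (gaussMix_pos _ r hM hp0) hle
  rw [Real.log_mul (Real.exp_ne_zero _) (gaussMix_pos _ r hM hs₀).ne', Real.log_exp] at this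
  linarith

/-! ### A weak law of large numbers -/

/-- If `φ` is square integrable with positive mean, then the sum of `φ` over `N` independent
samples is positive with probability tending to one. -/
lemma tendsto_measure_sum_nonpos {E : Type*} [MeasurableSpace E] (μ : Measure E)
    [IsProbabilityMeasure μ] {φ : E → ℝ} (hφ : MemLp φ 2 μ) (hpos : 0 < ∫ x, φ x ∂μ) :
    Tendsto (fun N : ℕ => (Measure.pi fun _ : Fin N => μ) {r | ∑ n, φ (r n) ≤ 0})
      atTop (𝓝 0) := by
  set m := ∫ x, φ x ∂μ with hm
  have hbound : ∀ N : ℕ, 0 < N → (Measure.pi fun _ : Fin N => μ) {r | ∑ n, φ (r n) ≤ 0} ≤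
      ENNReal.ofReal ((Var[φ; μ] / m ^ 2) / N) := by
    intro N hN
    have hN' : (0 : ℝ) < N := by exact_mod_cast hN
    set P := Measure.pi fun _ : Fin N => μ
    set X : (Fin N → E) → ℝ := ∑ n, fun r => φ (r n) with hX
    have hXi : ∀ n : Fin N, MemLp (fun r : Fin N → E => φ (r n)) 2 P := fun n =>
      hφ.comp_measurePreserving (measurePreserving_eval _ n)
    have hXm : MemLp X 2 P := memLp_finsetSum' _ fun n _ => hXi n
    have hmean : P[X] = N * m := by
      have : X = fun r => ∑ n, φ (r n) := by ext r; simp [hX]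
      rw [this, integral_finsetSum _ fun n _ => (hXi n).integrable (by norm_num)]
      have : ∀ n : Fin N, ∫ r, φ (r n) ∂P = m := fun n =>
        integral_comp_eval (μ := fun _ : Fin N => μ) (i := n) hφ.aestronglyMeasurable
      simp [this]
    have hvar : Var[X; P] = N * Var[φ; μ] := by
      rw [hX, variance_sum_pi (fun _ => hφ)]
      simp
    -- Chebyshev: a nonpositive sum deviates from its mean `N * m` by at least `N * m`, while its
    -- variance is only of order `N`.
    have hc := meas_ge_le_variance_div_sq hXm (c := N * m) (by positivity)
    rw [hmean, hvar] at hc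
    refine (measure_mono fun r hr => ?_).trans (hc.trans (le_of_eq ?_))
    · simp only [Set.mem_ofPred_eq] at hr ⊢
      have : X r = ∑ n, φ (r n) := by simp [hX]
      rw [this]
      rw [abs_sub_comm]
      exact le_trans (by linarith) (le_abs_self _)
    · congr 1
      field_simp
  have hlim : Tendsto (fun N : ℕ => ENNReal.ofReal ((Var[φ; μ] / m ^ 2) / N)) atTop (𝓝 0) := by
    have := ENNReal.tendsto_ofReal (tendsto_const_div_atTop_nhds_zero_nat (Var[φ; μ] / m ^ 2))
    simpa using this
  refine tendsto_of_tendsto_of_tendsto_of_le_of_le' tendsto_const_nhds hlim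
    (Eventually.of_forall fun _ => zero_le) ?_
  filter_upwards [eventually_gt_atTop 0] with N hN using hbound N hN

/-! ### The law of one sample -/

lemma gaussianPDFReal_mul_gaussianPDFReal {s : ℝ} (hs : 0 < s) (z : ℂ) :
    gaussianPDFReal 0 (s / 2).toNNReal z.re * gaussianPDFReal 0 (s / 2).toNNReal z.im =
      (Real.pi * s)⁻¹ * Real.exp (-(‖z‖ ^ 2 / s)) := by
  have h : ((s / 2).toNNReal : ℝ) = s / 2 := Real.coe_toNNReal _ (by positivity)
  have e : 2 * Real.pi * (s / 2) = Real.pi * s := by ring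
  have e' : 2 * (s / 2) = s := by ring
  rw [gaussianPDFReal_def]
  simp only [h, e, e', sub_zero]
  rw [mul_mul_mul_comm, ← Real.exp_add, ← mul_inv, Real.mul_self_sqrt (by positivity),
    Complex.sq_norm, Complex.normSq_apply]
  congr 2
  ring

instance isProbabilityMeasure_complexGaussian (s : ℝ) :
    IsProbabilityMeasure (complexGaussian s) :=
  Measure.isProbabilityMeasure_map (by fun_prop)

lemma complexGaussian_eq_withDensity {s : ℝ} (hs : 0 < s) :
    complexGaussian s = volume.withDensity
      fun z => ENNReal.ofReal ((Real.pi * s)⁻¹ * Real.exp (-(‖z‖ ^ 2 / s))) := by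
  have hv : (s / 2).toNNReal ≠ 0 := by simpa using hs
  have hfun : (fun x : ℝ × ℝ => (x.1 : ℂ) + (x.2 : ℂ) * Complex.I) =
      Complex.measurableEquivRealProd.symm := by
    ext x
    exact (Complex.equivRealProd_symm_apply x).symm
  have hmp := Complex.volume_preserving_equiv_real_prod.symm
  unfold complexGaussian
  rw [gaussianReal_of_var_ne_zero _ hv, prod_withDensity (by fun_prop) (by fun_prop), hfun,
    ← Measure.volume_eq_prod]
  ext B hB
  rw [Measure.map_apply (MeasurableEquiv.measurable _) hB,
    withDensity_apply _ (MeasurableEquiv.measurable _ hB), withDensity_apply _ hB,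
    ← hmp.setLIntegral_comp_preimage_emb (MeasurableEquiv.measurableEmbedding _)]
  refine lintegral_congr fun x => ?_
  rw [← gaussianPDFReal_mul_gaussianPDFReal hs, gaussianPDF, gaussianPDF,
    ← ENNReal.ofReal_mul (gaussianPDFReal_nonneg _ _ _)]
  rfl

lemma memLp_id_complexGaussian (s : ℝ) {p : ENNReal} (hp : p ≠ ⊤) :
    MemLp (fun z : ℂ => z) p (complexGaussian s) := by
  unfold complexGaussian
  rw [memLp_map_measure_iff (by fun_prop) (by fun_prop)]
  have h : MemLp (fun x : ℝ => (x : ℂ)) p (gaussianReal 0 (s / 2).toNNReal) :=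
    (memLp_id_gaussianReal' p hp).ofReal
  exact (h.comp_fst _).add ((h.comp_snd _).mul_const Complex.I)

/-- The law of a single sample: a uniformly chosen center plus `CN(0, s)` noise. -/
noncomputable def mixLaw {M : ℕ} (c : Fin M → ℂ) (s : ℝ) : Measure ℂ :=
  ((uniformOn (Set.univ : Set (Fin M))).prod (complexGaussian s)).map fun x => c x.1 + x.2

section

variable {M : ℕ} (c : Fin M → ℂ)

lemma measurable_center_add : Measurable fun x : Fin M × ℂ => c x.1 + x.2 :=
  ((measurable_of_finite c).comp measurable_fst).add measurable_snd

lemma isProbabilityMeasure_mixLaw (hM : 0 < M) (s : ℝ) : IsProbabilityMeasure (mixLaw c s) := by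
  have : Nonempty (Fin M) := ⟨⟨0, hM⟩⟩
  exact Measure.isProbabilityMeasure_map (measurable_center_add c).aemeasurable

lemma memLp_id_mixLaw (hM : 0 < M) (s : ℝ) {p : ENNReal} (hp : p ≠ ⊤) :
    MemLp (fun z : ℂ => z) p (mixLaw c s) := by
  have : Nonempty (Fin M) := ⟨⟨0, hM⟩⟩
  unfold mixLaw
  rw [memLp_map_measure_iff (by fun_prop) (measurable_center_add c).aemeasurable]
  have hc : MemLp c p (uniformOn (Set.univ : Set (Fin M))) := by
    refine MemLp.of_bound (measurable_of_finite c).aestronglyMeasurable (∑ m, ‖c m‖)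
      (Eventually.of_forall fun m => ?_)
    exact Finset.single_le_sum (f := fun m => ‖c m‖) (fun m _ => norm_nonneg _)
      (Finset.mem_univ m)
  exact (hc.comp_fst _).add ((memLp_id_complexGaussian s hp).comp_snd _)

/-- Functions of at most quadratic growth are square integrable under a Gaussian mixture. -/
lemma memLp_two_mixLaw (hM : 0 < M) (s : ℝ) {φ : ℂ → ℝ} (hφ : Measurable φ) {C : ℝ}
    (hC : ∀ r, |φ r| ≤ C * (1 + ‖r‖ ^ 2)) : MemLp φ 2 (mixLaw c s) := by
  have := isProbabilityMeasure_mixLaw c hM s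
  have h4 : MemLp (fun z : ℂ => ‖z‖) 4 (mixLaw c s) :=
    (memLp_id_mixLaw c hM s (by norm_num)).norm
  have h2 : MemLp (fun z : ℂ => ‖z‖ ^ 2) 2 (mixLaw c s) := by
    rw [memLp_two_iff_integrable_sq (by fun_prop)]
    have := h4.integrable_norm_pow (by norm_num)
    refine this.congr (Eventually.of_forall fun z => ?_)
    simp only [norm_norm]
    ring
  refine MemLp.mono' (((memLp_const (1 : ℝ)).add h2).const_mul C) hφ.aestronglyMeasurable
    (Eventually.of_forall fun r => ?_)
  simpa using hC r

lemma mixLaw_eq_withDensity (hM : 0 < M) {s : ℝ} (hs : 0 < s) :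
    mixLaw c s = volume.withDensity fun r => ENNReal.ofReal (gaussMix c s r) := by
  have hM' : (0 : ℝ) < M := by exact_mod_cast hM
  have hne : Nonempty (Fin M) := ⟨⟨0, hM⟩⟩
  ext B hB
  have hg : ∀ m, Measurable fun r : ℂ =>
      ENNReal.ofReal ((Real.pi * s)⁻¹ * Real.exp (-(‖r - c m‖ ^ 2 / s))) := fun m => by
    fun_prop
  have hshift : ∀ m, complexGaussian s {w | c m + w ∈ B} =
      ∫⁻ r in B, ENNReal.ofReal ((Real.pi * s)⁻¹ * Real.exp (-(‖r - c m‖ ^ 2 / s))) := by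
    intro m
    change complexGaussian s ((fun w => c m + w) ⁻¹' B) = _
    rw [complexGaussian_eq_withDensity hs,
      withDensity_apply _ (measurable_const_add (c m) hB)]
    refine Eq.trans ?_
      ((measurePreserving_add_left (volume : Measure ℂ) (c m)).setLIntegral_comp_preimage_emb
        (MeasurableEquiv.addLeft (c m)).measurableEmbedding _ B)
    simp
  unfold mixLaw
  rw [Measure.map_apply (measurable_center_add c) hB,
    Measure.prod_apply (measurable_center_add c hB), withDensity_apply _ hB]
  have hdens : ∀ r, ENNReal.ofReal (gaussMix c s r) = (M : ENNReal)⁻¹ * ∑ m,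
      ENNReal.ofReal ((Real.pi * s)⁻¹ * Real.exp (-(‖r - c m‖ ^ 2 / s))) := by
    intro r
    unfold gaussMix
    rw [ENNReal.ofReal_mul (by positivity), ENNReal.ofReal_sum_of_nonneg fun m _ => by positivity,
      one_div, ENNReal.ofReal_inv_of_pos hM', ENNReal.ofReal_natCast]
  simp only [hdens]
  rw [lintegral_const_mul _ (by fun_prop), lintegral_finsetSum _ fun m _ => hg m]
  simp only [← hshift]
  rw [uniformOn, ProbabilityTheory.cond, lintegral_smul_measure]
  simp [Measure.restrict_univ, lintegral_count, tsum_fintype, Set.preimage]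

/-- The observations are independent samples of the Gaussian mixture. -/
lemma observationLaw_eq_pi (H : Modulation) (hH : 0 < H.order) (u : Param) (N : ℕ) :
    observationLaw H u N =
      Measure.pi fun _ : Fin N => mixLaw (fun m => u.gain * H.symbol m) u.noise := by
  have := isProbabilityMeasure_mixLaw (fun m => u.gain * H.symbol m) hH u.noise
  have : Nonempty (Fin H.order) := ⟨⟨0, hH⟩⟩
  exact Measure.pi_map_pi
    (μ := fun _ : Fin N => (uniformOn (Set.univ : Set (Fin H.order))).prod (complexGaussian u.noise))
    (f := fun _ x => u.gain * H.symbol x.1 + x.2)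
    (hμ := fun _ => by change SigmaFinite (mixLaw (fun m => u.gain * H.symbol m) u.noise); infer_instance)
    fun _ => (measurable_center_add fun m => u.gain * H.symbol m).aemeasurable

end

/-! ### Positivity of the Kullback-Leibler divergence -/

section

variable {M M' : ℕ} (c : Fin M → ℂ) (c' : Fin M' → ℂ) {s s' : ℝ}

lemma lintegral_gaussMix (hM : 0 < M) (hs : 0 < s) :
    ∫⁻ r, ENNReal.ofReal (gaussMix c s r) = 1 := by
  have := isProbabilityMeasure_mixLaw c hM s
  have h := measure_univ (μ := mixLaw c s)
  rwa [mixLaw_eq_withDensity c hM hs, withDensity_apply _ .univ, Measure.restrict_univ] at h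

lemma integrable_gaussMix (hM : 0 < M) (hs : 0 < s) : Integrable (gaussMix c s) := by
  refine ⟨(continuous_gaussMix c s).aestronglyMeasurable, ?_⟩
  rw [hasFiniteIntegral_iff_ofReal
    (Eventually.of_forall fun r => (gaussMix_pos c r hM hs).le), lintegral_gaussMix c hM hs]
  simp

lemma integral_gaussMix (hM : 0 < M) (hs : 0 < s) : ∫ r, gaussMix c s r = 1 := by
  rw [integral_eq_lintegral_of_nonneg_ae
    (Eventually.of_forall fun r => (gaussMix_pos c r hM hs).le)
    (continuous_gaussMix c s).aestronglyMeasurable, lintegral_gaussMix c hM hs]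
  simp

lemma memLp_two_log_gaussMix (hM : 0 < M) (hM' : 0 < M') (hs' : 0 < s') :
    MemLp (fun r => Real.log (gaussMix c' s' r)) 2 (mixLaw c s) := by
  obtain ⟨C, -, hC⟩ := abs_log_gaussMix_le c' hM' hs'
  exact memLp_two_mixLaw c hM s (continuous_gaussMix c' s').measurable.log hC

/-- Gibbs' inequality: `log x ≤ x - 1`, strictly for `x ≠ 1`, is applied to the ratio `x = f' / f`,
whose mean under `f` is `∫ f' = 1`. By continuity the two densities differ on an open set as soon as
they differ at a point, so the inequality is strict on a set of positive measure. -/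
lemma integral_log_gaussMix_sub_pos (hM : 0 < M) (hM' : 0 < M') (hs : 0 < s) (hs' : 0 < s')
    (hne : ∃ r, gaussMix c s r ≠ gaussMix c' s' r) :
    0 < ∫ r, (Real.log (gaussMix c s r) - Real.log (gaussMix c' s' r)) ∂mixLaw c s := by
  have := isProbabilityMeasure_mixLaw c hM s
  set f := gaussMix c s with hf
  set f' := gaussMix c' s' with hf'
  have hf0 : ∀ r, 0 < f r := fun r => gaussMix_pos c r hM hs
  have hf0' : ∀ r, 0 < f' r := fun r => gaussMix_pos c' r hM' hs'
  have hfc : Continuous f := continuous_gaussMix c s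
  have hfc' : Continuous f' := continuous_gaussMix c' s'
  have hmeas : Measurable fun r => ENNReal.ofReal (f r) := by fun_prop
  have hlt : ∀ᵐ r : ℂ, ENNReal.ofReal (f r) < ⊤ := Eventually.of_forall fun _ => by simp
  have hmul : ∀ r, (ENNReal.ofReal (f r)).toReal • (f' r / f r) = f' r := fun r => by
    rw [ENNReal.toReal_ofReal (hf0 r).le, smul_eq_mul, mul_div_cancel₀ _ (hf0 r).ne']
  have hq_int : Integrable (fun r => f' r / f r) (mixLaw c s) := by
    rw [mixLaw_eq_withDensity c hM hs, integrable_withDensity_iff_integrable_smul' hmeas hlt]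
    simp only [hmul]
    exact integrable_gaussMix c' hM' hs'
  have hq : ∫ r, f' r / f r ∂mixLaw c s = 1 := by
    rw [mixLaw_eq_withDensity c hM hs, integral_withDensity_eq_integral_toReal_smul hmeas hlt]
    simp only [hmul]
    exact integral_gaussMix c' hM' hs'
  have hlog : Integrable (fun r => Real.log (f r) - Real.log (f' r)) (mixLaw c s) :=
    ((memLp_two_log_gaussMix c c hM hM hs).sub
      (memLp_two_log_gaussMix c c' hM hM' hs')).integrable (by norm_num)
  set h : ℂ → ℝ := fun r => (Real.log (f r) - Real.log (f' r)) + (f' r / f r - 1) with hh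
  have hh_int : Integrable h (mixLaw c s) := hlog.add (hq_int.sub (integrable_const 1))
  have hlogq : ∀ r, Real.log (f' r / f r) = Real.log (f' r) - Real.log (f r) := fun r =>
    Real.log_div (hf0' r).ne' (hf0 r).ne'
  have hh0 : ∀ r, 0 ≤ h r := fun r => by
    have h1 := Real.log_le_sub_one_of_pos (div_pos (hf0' r) (hf0 r))
    rw [hlogq] at h1
    simp only [hh]
    linarith
  have hint : ∫ r, h r ∂mixLaw c s =
      ∫ r, (Real.log (f r) - Real.log (f' r)) ∂mixLaw c s := by
    have h0 : ∫ r, (f' r / f r - 1) ∂mixLaw c s = 0 := by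
      rw [integral_sub hq_int (integrable_const 1), hq]
      simp
    exact (integral_add hlog (hq_int.sub (integrable_const 1))).trans
      ((congrArg (_ + ·) h0).trans (add_zero _))
  rw [← hint, integral_pos_iff_support_of_nonneg hh0 hh_int]
  have hopen : IsOpen {r | f r ≠ f' r} := isOpen_ne_fun hfc hfc'
  have hsub : {r | f r ≠ f' r} ⊆ Function.support h := by
    intro r hr
    have hr1 : f' r / f r ≠ 1 := fun e => hr ((div_eq_one_iff_eq (hf0 r).ne').1 e).symm
    have h1 := Real.log_lt_sub_one_of_pos (div_pos (hf0' r) (hf0 r)) hr1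
    rw [hlogq] at h1
    simp only [Function.mem_support, hh]
    exact ne_of_gt (by linarith)
  refine lt_of_lt_of_le (pos_iff_ne_zero.2 fun h0 => ?_) (measure_mono hsub)
  -- The density vanishes nowhere, so a null set of the mixture is Lebesgue null, which a nonempty
  -- open set is not.
  rw [mixLaw_eq_withDensity c hM hs, withDensity_apply_eq_zero hmeas] at h0
  have hset : {x | ENNReal.ofReal (gaussMix c s x) ≠ 0} ∩ {r | f r ≠ f' r} =
      {r | f r ≠ f' r} := by
    refine Set.inter_eq_right.2 fun r _ => ?_
    simpa using hf0 r
  rw [hset] at h0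
  exact (hopen.measure_pos volume hne).ne' h0

/-! ### Identifiability of finite Gaussian mixtures -/

/-- The mixture with the larger variance dominates at infinity. -/
lemma variance_le_of_gaussMix_eq (hM' : 0 < M') (hs : 0 < s) (hs' : 0 < s')
    (h : ∀ r, gaussMix c s r = gaussMix c' s' r) : s' ≤ s := by
  by_contra! hlt
  -- Both mixtures are compared along the ray `c' k + t`, `t → ∞`, after multiplication by `exp (t ^
  -- 2 / s')`. If `s < s'`, the first tends to `0`, while the component `k` alone keeps the second
  -- above a positive constant.
  let k : Fin M' := ⟨0, hM'⟩
  have hM'' : (0 : ℝ) < M' := by exact_mod_cast hM'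
  have hlim : ∀ m, Tendsto (fun t : ℝ => (Real.pi * s)⁻¹ *
      Real.exp (t ^ 2 / s' - ‖c' k + t - c m‖ ^ 2 / s)) atTop (𝓝 0) := by
    intro m
    rw [← mul_zero (Real.pi * s)⁻¹]
    refine (Real.tendsto_exp_atBot.comp ?_).const_mul _
    set d := c' k - c m with hd
    have hα : 0 < 1 / s - 1 / s' := sub_pos.2 (one_div_lt_one_div_of_lt hs hlt)
    have e : ∀ t : ℝ, t ^ 2 / s' - ‖c' k + t - c m‖ ^ 2 / s =
        -(t * ((1 / s - 1 / s') * t + 2 * d.re / s)) - ‖d‖ ^ 2 / s := by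
      intro t
      have h1 : c' k + t - c m = d + (t : ℂ) := by rw [hd]; ring
      have h2 : ‖d + (t : ℂ)‖ ^ 2 = ‖d‖ ^ 2 + 2 * d.re * t + t ^ 2 := by
        simp only [Complex.sq_norm, Complex.normSq_apply, Complex.add_re, Complex.add_im,
          Complex.ofReal_re, Complex.ofReal_im]
        ring
      rw [h1, h2]
      field_simp
      ring
    simp only [e]
    refine tendsto_atBot_add_const_right _ _ (tendsto_neg_atTop_atBot.comp ?_)
    exact tendsto_id.atTop_mul_atTop₀
      (tendsto_atTop_add_const_right _ _ (tendsto_id.const_mul_atTop hα))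
  have hsum := (tendsto_finsetSum Finset.univ fun m _ => hlim m).const_mul (1 / (M : ℝ))
  simp only [Finset.sum_const_zero, mul_zero] at hsum
  have hlow : ∀ t : ℝ, (1 / (M' : ℝ)) * (Real.pi * s')⁻¹ ≤ (1 / (M : ℝ)) * ∑ m,
      (Real.pi * s)⁻¹ * Real.exp (t ^ 2 / s' - ‖c' k + t - c m‖ ^ 2 / s) := by
    intro t
    have h1 : (1 / (M' : ℝ)) * ((Real.pi * s')⁻¹ * Real.exp (-(t ^ 2 / s'))) ≤
        gaussMix c' s' (c' k + t) := by
      unfold gaussMix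
      refine mul_le_mul_of_nonneg_left ?_ (by positivity)
      have := Finset.single_le_sum
        (f := fun m => (Real.pi * s')⁻¹ * Real.exp (-(‖c' k + t - c' m‖ ^ 2 / s')))
        (fun m _ => by positivity) (Finset.mem_univ k)
      simpa using this
    rw [← h] at h1
    have h2 := mul_le_mul_of_nonneg_left h1 (Real.exp_pos (t ^ 2 / s')).le
    have h3 : Real.exp (t ^ 2 / s') *
        ((1 / (M' : ℝ)) * ((Real.pi * s')⁻¹ * Real.exp (-(t ^ 2 / s')))) =
        (1 / (M' : ℝ)) * (Real.pi * s')⁻¹ := by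
      rw [Real.exp_neg]
      field_simp
    rw [h3] at h2
    refine h2.trans (le_of_eq ?_)
    unfold gaussMix
    rw [mul_left_comm, Finset.mul_sum Finset.univ _ (Real.exp _)]
    congr 1
    refine Finset.sum_congr rfl fun m _ => ?_
    rw [mul_left_comm, ← Real.exp_add, ← sub_eq_add_neg]
  have := ge_of_tendsto' hsum hlow
  have hp : 0 < (1 / (M' : ℝ)) * (Real.pi * s')⁻¹ := by positivity
  linarith

/-- The exponential character `r ↦ exp (2 ⟪r, z⟫ / s)` of the additive group `ℂ`. -/
noncomputable def expChar (s : ℝ) (z : ℂ) : Multiplicative ℂ →* ℝ where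
  toFun r := Real.exp (2 * inner ℝ r.toAdd z / s)
  map_one' := by simp
  map_mul' x y := by
    rw [← Real.exp_add, toAdd_mul, inner_add_left]
    congr 1
    ring

lemma expChar_injective (hs : s ≠ 0) : Function.Injective (expChar s) := by
  intro z w hzw
  refine ext_inner_left ℝ fun r => ?_
  have h := DFunLike.congr_fun hzw (Multiplicative.ofAdd r)
  have h' : 2 * inner ℝ r z / s = 2 * inner ℝ r w / s := Real.exp_injective h
  field_simp at h'
  linarith

/-- Equal mixtures of the same variance put the same mass on every center. -/
lemma card_filter_eq_of_gaussMix_eq (hs : 0 < s)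
    (h : ∀ r, gaussMix c s r = gaussMix c' s r) (z : ℂ) :
    (1 / (M : ℝ)) * (Finset.univ.filter fun m => c m = z).card =
      (1 / (M' : ℝ)) * (Finset.univ.filter fun m => c' m = z).card := by
  -- Dedekind's theorem: distinct characters of a monoid are linearly independent.
  have hli : LinearIndependent ℝ fun z : ℂ => (expChar s z : Multiplicative ℂ → ℝ) :=
    (linearIndependent_monoidHom (Multiplicative ℂ) ℝ).comp _ (expChar_injective hs.ne')
  -- Expanding the square pulls out a Gaussian factor common to all mixtures of variance `s`; what
  -- remains is a linear combination of characters indexed by the centers.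
  have key : ∀ {K : ℕ} (b : Fin K → ℂ) (r : ℂ), gaussMix b s r =
      ((Real.pi * s)⁻¹ * Real.exp (-(‖r‖ ^ 2 / s))) *
        ∑ m, ((1 / (K : ℝ)) * Real.exp (-(‖b m‖ ^ 2 / s))) *
          expChar s (b m) (Multiplicative.ofAdd r) := by
    intro K b r
    unfold gaussMix
    rw [Finset.mul_sum, Finset.mul_sum]
    refine Finset.sum_congr rfl fun m _ => ?_
    have e : Real.exp (-(‖r - b m‖ ^ 2 / s)) = Real.exp (-(‖r‖ ^ 2 / s)) *
        Real.exp (-(‖b m‖ ^ 2 / s)) * expChar s (b m) (Multiplicative.ofAdd r) := by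
      change _ = _ * _ * Real.exp (2 * inner ℝ r (b m) / s)
      rw [← Real.exp_add, ← Real.exp_add, @norm_sub_sq_real]
      congr 1
      ring
    rw [e]
    ring
  let l : ∀ {K : ℕ}, (Fin K → ℂ) → ℂ →₀ ℝ := fun {K} b =>
    ∑ m, Finsupp.single (b m) ((1 / (K : ℝ)) * Real.exp (-(‖b m‖ ^ 2 / s)))
  have hl : Finsupp.linearCombination ℝ (fun z : ℂ => (expChar s z : Multiplicative ℂ → ℝ)) (l c) =
      Finsupp.linearCombination ℝ (fun z : ℂ => (expChar s z : Multiplicative ℂ → ℝ)) (l c') := by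
    funext x
    have hx := h x.toAdd
    rw [key, key] at hx
    have := mul_left_cancel₀ (by positivity) hx
    simpa only [l, map_sum, Finsupp.linearCombination_single, Finset.sum_apply, Pi.smul_apply, ofAdd_toAdd,
      smul_eq_mul] using this
  have hl' : l c z = l c' z := by rw [hli hl]
  have hval : ∀ {K : ℕ} (b : Fin K → ℂ), l b z =
      Real.exp (-(‖z‖ ^ 2 / s)) *
        ((1 / (K : ℝ)) * (Finset.univ.filter fun m => b m = z).card) := by
    intro K b
    simp only [l, Finsupp.finsetSum_apply, Finsupp.single_apply]
    rw [← Finset.sum_filter, Finset.sum_congr rfl (g := fun _ =>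
      (1 / (K : ℝ)) * Real.exp (-(‖z‖ ^ 2 / s)))
      fun m hm => by rw [(Finset.mem_filter.1 hm).2]]
    simp
    ring
  rw [hval, hval] at hl'
  exact mul_left_cancel₀ (Real.exp_ne_zero _) hl'

end

/-- If a mixture over at least two distinct centers equals a mixture over the scaled points of an
injective constellation, then both have the same number of centers and the same set of centers. -/
lemma card_eq_and_range_eq_of_gaussMix_eq {M M' : ℕ} {c : Fin M → ℂ} {I' : Fin M' → ℂ} {g' : ℂ}
    {s s' : ℝ} (hM : 2 ≤ M) (hM' : 0 < M') (hc : Function.Injective c)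
    (hI' : Function.Injective I') (hs : 0 < s) (hs' : 0 < s')
    (h : ∀ r, gaussMix c s r = gaussMix (fun m => g' * I' m) s' r) :
    M = M' ∧ Set.range c = Set.range fun m => g' * I' m := by
  set c' : Fin M' → ℂ := fun m => g' * I' m with hc'
  obtain rfl : s = s' := le_antisymm
    (variance_le_of_gaussMix_eq c' c (by omega) hs' hs fun r => (h r).symm)
    (variance_le_of_gaussMix_eq c c' hM' hs hs' h)
  have hcount := card_filter_eq_of_gaussMix_eq c c' hs h
  have hMr : (0 : ℝ) < M := by exact_mod_cast (by omega : 0 < M)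
  have hMr' : (0 : ℝ) < M' := by exact_mod_cast hM'
  have hmem : ∀ {K : ℕ} (b : Fin K → ℂ) (z : ℂ),
      0 < (Finset.univ.filter fun m => b m = z).card ↔ z ∈ Set.range b := by
    intro K b z
    simp [Finset.card_pos, Finset.filter_nonempty_iff]
  have hrange : ∀ z, z ∈ Set.range c ↔ z ∈ Set.range c' := by
    intro z
    rw [← hmem, ← hmem]
    have hz := hcount z
    rw [← @Nat.cast_pos ℝ, ← @Nat.cast_pos ℝ]
    constructor <;> intro hp
    · have : 0 < (1 / (M : ℝ)) * (Finset.univ.filter fun m => c m = z).card := by positivity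
      rw [hz] at this
      exact pos_of_mul_pos_right this (by positivity)
    · have : 0 < (1 / (M' : ℝ)) * (Finset.univ.filter fun m => c' m = z).card := by positivity
      rw [← hz] at this
      exact pos_of_mul_pos_right this (by positivity)
  have hr : Set.range c = Set.range c' := Set.ext hrange
  refine ⟨?_, hr⟩
  -- A zero gain would collapse all centers to the origin, whereas `c` takes at least two values.
  have hg' : g' ≠ 0 := by
    rintro rfl
    have h0 : ∀ m, c m = 0 := fun m => by
      obtain ⟨k, hk⟩ := (hrange (c m)).1 ⟨m, rfl⟩
      simp [← hk, hc']
    have := hc ((h0 ⟨0, by omega⟩).trans (h0 ⟨1, by omega⟩).symm)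
    simp at this
  have hc'i : Function.Injective c' := fun m k hmk => hI' (mul_left_cancel₀ hg' hmk)
  have h1 := Set.ncard_range_of_injective hc
  have h2 := Set.ncard_range_of_injective hc'i
  rw [hr, h2] at h1
  simpa using h1.symm

/-! ### Modulation formats -/

lemma Modulation.two_le_order (H : Modulation) : 2 ≤ H.order := by
  cases H with
  | psk M hM φ => exact hM
  | qam M pt hd hp ha =>
    obtain ⟨m, m', h⟩ := ha
    change 2 ≤ M
    by_contra! hM
    have : m = m' := Fin.ext (by omega)
    exact h (by rw [this])

lemma Modulation.symbol_injective (H : Modulation) : Function.Injective H.symbol := by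
  cases H with
  | qam M pt hd hp ha => exact hd
  | psk M hM φ =>
    intro m m' h
    change Fin M at m m'
    obtain ⟨n, hn⟩ := Complex.exp_eq_exp_iff_exists_int.1 h
    have hM' : (0 : ℝ) < M := by exact_mod_cast (by omega : 0 < M)
    have h1 := congrArg Complex.im hn
    simp at h1
    have h2 : (m : ℝ) = m' + n * M := by
      have hpi := Real.pi_pos
      field_simp at h1
      have h3 : (2 * Real.pi) * (m : ℝ) = (2 * Real.pi) * (m' + n * M) := by linarith
      exact mul_left_cancel₀ (by positivity) h3
    have h4 : (m : ℤ) = m' + n * M := by exact_mod_cast h2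
    have h5 : (m : ℤ) < M := by exact_mod_cast m.2
    have h6 : (m' : ℤ) < M := by exact_mod_cast m'.2
    -- Both indices lie in `[0, M)`, so they cannot differ by a nonzero multiple of `M`.
    have h7 : n = 0 := by
      by_contra hne
      rcases lt_or_gt_of_ne hne with hn0 | hn0
      · nlinarith [(by omega : (0 : ℤ) ≤ m)]
      · nlinarith [(by omega : (0 : ℤ) ≤ m')]
    rw [h7] at h4
    exact Fin.ext (by omega)

/-- This criterion depends only on the set of symbols and survives multiplication by a nonzero gain,
so the family can be recovered from the centers of a mixture. -/
lemma Modulation.family_eq_psk_iff (H : Modulation) :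
    H.family = .psk ↔ ∀ m m', ‖H.symbol m‖ = ‖H.symbol m'‖ := by
  cases H with
  | qam M pt hd hp ha =>
    obtain ⟨m, m', h⟩ := ha
    exact iff_of_false (fun e : Family.qam = Family.psk => by cases e) fun e => h (e m m')
  | psk M hM φ =>
    refine ⟨fun _ m m' => ?_, fun _ => rfl⟩
    simp only [Modulation.symbol, Complex.norm_exp_ofReal_mul_I]

/-- The likelihood functions determine family and order of the format. -/
lemma exists_gaussMix_ne {H H' : Modulation} (hne : (H.family, H.order) ≠ (H'.family, H'.order))
    {g g' : ℂ} (hg : g ≠ 0) {s s' : ℝ} (hs : 0 < s) (hs' : 0 < s') :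
    ∃ r, gaussMix (fun m => g * H.symbol m) s r ≠ gaussMix (fun m => g' * H'.symbol m) s' r := by
  by_contra! h
  have h2' := H'.two_le_order
  obtain ⟨ho, hr⟩ := card_eq_and_range_eq_of_gaussMix_eq H.two_le_order (by omega)
    (fun m k hmk => H.symbol_injective (mul_left_cancel₀ hg hmk)) H'.symbol_injective hs hs' h
  have hg' : g' ≠ 0 := by
    rintro rfl
    have h0 : ∀ m, H.symbol m = 0 := fun m => by
      obtain ⟨k, hk⟩ := hr.subset ⟨m, rfl⟩
      simpa [hg] using hk.symm
    have h2 := H.two_le_order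
    have := H.symbol_injective ((h0 ⟨0, by omega⟩).trans (h0 ⟨1, by omega⟩).symm)
    simp at this
  have aux : ∀ (K : Modulation) (a : ℂ), a ≠ 0 → (K.family = .psk ↔
      ∀ x ∈ Set.range fun m => a * K.symbol m, ∀ y ∈ Set.range fun m => a * K.symbol m,
        ‖x‖ = ‖y‖) := by
    intro K a ha
    rw [K.family_eq_psk_iff]
    simp [ha]
  have hfam : H.family = .psk ↔ H'.family = .psk := by
    rw [aux H g hg, aux H' g' hg', hr]
  refine hne (Prod.ext ?_ ho)
  change H.family = H'.family
  cases h1 : H.family <;> cases h3 : H'.family <;> simp_all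

/-! ### Uniform upper bounds on the log-likelihood -/

/-- Union bound for events of vanishing probability. Taking `b = c` gives plain monotonicity. Only
outer measure is involved, so the events, which quantify over uncountably many parameters, need not
be measurable. -/
lemma tendsto_measure_of_subset_union {Ω : ℕ → Type*} [∀ N, MeasurableSpace (Ω N)]
    (P : ∀ N, Measure (Ω N)) (a b c : ∀ N, Set (Ω N))
    (h : ∀ᶠ N in atTop, a N ⊆ b N ∪ c N) (hb : Tendsto (fun N => P N (b N)) atTop (𝓝 0))
    (hc : Tendsto (fun N => P N (c N)) atTop (𝓝 0)) :
    Tendsto (fun N => P N (a N)) atTop (𝓝 0) := by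
  have hbc := hb.add hc
  rw [add_zero] at hbc
  refine tendsto_of_tendsto_of_tendsto_of_le_of_le' tendsto_const_nhds hbc
    (Eventually.of_forall fun _ => zero_le) ?_
  filter_upwards [h] with N hN using (measure_mono hN).trans (measure_union_le _ _)

/-- On a compact set of gains and positive variances whose mean log-likelihoods are smaller than
the mean of `ψ`, the log-likelihood of the sample stays below the sum of `ψ` with probability
tending to one. -/
lemma tendsto_measure_exists_le_of_isCompact (μ : Measure ℂ) [IsProbabilityMeasure μ]
    (hμ : MemLp (fun r : ℂ => 1 + ‖r‖ ^ 2) 2 μ) {M : ℕ} (hM : 0 < M) (I : Fin M → ℂ)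
    (hlog : ∀ g s, 0 < s → MemLp (fun r => Real.log (gaussMix (fun m => g * I m) s r)) 2 μ)
    {ψ : ℂ → ℝ} (hψ : MemLp ψ 2 μ) {K : Set (ℂ × ℝ)} (hK : IsCompact K)
    (hKpos : ∀ p ∈ K, 0 < p.2)
    (hKψ : ∀ p ∈ K, 0 < ∫ r, (ψ r - Real.log (gaussMix (fun m => p.1 * I m) p.2 r)) ∂μ) :
    Tendsto (fun N : ℕ => (Measure.pi fun _ : Fin N => μ) {r | ∃ p ∈ K,
      ∑ n, ψ (r n) ≤ ∑ n, Real.log (gaussMix (fun m => p.1 * I m) p.2 (r n))})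
      atTop (𝓝 0) := by
  -- Vanishing probability passes to subsets and finite unions of parameter sets, so by compactness
  -- a neighbourhood of each parameter is enough.
  refine hK.induction_on (p := fun t => Tendsto (fun N : ℕ => (Measure.pi fun _ : Fin N => μ)
    {r | ∃ p ∈ t, ∑ n, ψ (r n) ≤
      ∑ n, Real.log (gaussMix (fun m => p.1 * I m) p.2 (r n))}) atTop (𝓝 0)) ?_ ?_ ?_ ?_
  · simp
  · intro t t' htt' ht'
    refine tendsto_measure_of_subset_union _ _ _ _ (Eventually.of_forall fun N r hr => ?_) ht' ht'
    obtain ⟨p, hp, h⟩ := hr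
    exact Or.inl ⟨p, htt' hp, h⟩
  · intro t t' ht ht'
    refine tendsto_measure_of_subset_union _ _ _ _ (Eventually.of_forall fun N r hr => ?_) ht ht'
    obtain ⟨p, hp | hp, h⟩ := hr
    exacts [Or.inl ⟨p, hp, h⟩, Or.inr ⟨p, hp, h⟩]
  · rintro ⟨g₀, s₀⟩ hp₀
    have hs₀ : 0 < s₀ := hKpos _ hp₀
    set f₀ : ℂ → ℝ := fun r => Real.log (gaussMix (fun m => g₀ * I m) s₀ r)
    set E := ∫ r, (ψ r - f₀ r) ∂μ with hE
    have hE0 : 0 < E := hKψ _ hp₀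
    set Q := ∫ r : ℂ, (1 + ‖r‖ ^ 2) ∂μ with hQ
    have hQ0 : 0 ≤ Q := integral_nonneg fun r => by positivity
    -- This makes `ε * Q < E`, so the mean stays positive after subtracting the error `ε * (1 + ‖r‖
    -- ^ 2)` of the local comparison.
    set ε := E / (2 * (Q + 1)) with hε
    have hε0 : 0 < ε := by positivity
    have hL : MemLp (fun r => (ψ r - f₀ r) - ε * (1 + ‖r‖ ^ 2)) 2 μ :=
      (hψ.sub (hlog g₀ s₀ hs₀)).sub (hμ.const_mul ε)
    have hmean : 0 < ∫ r, ((ψ r - f₀ r) - ε * (1 + ‖r‖ ^ 2)) ∂μ := by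
      have h1 : Integrable (fun r => ψ r - f₀ r) μ :=
        (hψ.sub (hlog g₀ s₀ hs₀)).integrable (by norm_num)
      have h2 : Integrable (fun r : ℂ => ε * (1 + ‖r‖ ^ 2)) μ :=
        (hμ.const_mul ε).integrable (by norm_num)
      rw [integral_sub h1 h2, integral_const_mul, ← hE, ← hQ, hε, sub_pos, div_mul_eq_mul_div,
        div_lt_iff₀ (by positivity)]
      nlinarith
    refine ⟨_, mem_nhdsWithin_of_mem_nhds (eventually_log_gaussMix_le hM I g₀ hs₀ hε0), ?_⟩
    have hlln := tendsto_measure_sum_nonpos μ hL hmean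
    refine tendsto_measure_of_subset_union _ _ _ _ (Eventually.of_forall fun N r hr => ?_)
      hlln hlln
    obtain ⟨p, hp, h⟩ := hr
    left
    change ∑ n, ((ψ (r n) - f₀ (r n)) - ε * (1 + ‖r n‖ ^ 2)) ≤ 0
    have h3 : ∑ n, Real.log (gaussMix (fun m => p.1 * I m) p.2 (r n)) ≤
        ∑ n, (f₀ (r n) + ε * (1 + ‖r n‖ ^ 2)) := Finset.sum_le_sum fun n _ => hp (r n)
    rw [Finset.sum_add_distrib] at h3
    rw [Finset.sum_sub_distrib, Finset.sum_sub_distrib]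
    linarith

/-- As `s → 0`, `k / s` dominates `log (1 / s)`. Half of `k / s` absorbs the logarithm through `log
x ≤ x - 1` at `x = k / (2 * s)`; the other half exceeds any constant. -/
lemma exists_forall_neg_log_sub_lt {k : ℝ} (hk : 0 < k) (e : ℝ) :
    ∃ δ > 0, ∀ s, 0 < s → s < δ → -Real.log (Real.pi * s) - k / s < e := by
  set b := |Real.log (Real.pi * k / 2)| + |e| + 1
  have hb : 0 < b := by positivity
  refine ⟨k / (2 * b), by positivity, fun s hs hsδ => ?_⟩
  have h1 := Real.log_le_sub_one_of_pos (x := k / (2 * s)) (by positivity)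
  have h2 : Real.log (k / (2 * s)) = Real.log (Real.pi * k / 2) - Real.log (Real.pi * s) := by
    rw [← Real.log_div (by positivity) (by positivity)]
    congr 1
    field_simp
  have h3 : b < k / (2 * s) := by
    rw [lt_div_iff₀ (by positivity)] at hsδ ⊢
    linarith
  have h4 : k / s = 2 * (k / (2 * s)) := by field_simp
  have h5 := neg_abs_le (Real.log (Real.pi * k / 2))
  have h6 := neg_abs_le e
  rw [h4]
  linarith

/-- Uniformly over bounded gains and small variances, the log-likelihood of the sample stays below
the sum of `ψ` with probability tending to one. -/
lemma exists_tendsto_measure_exists_le_of_variance_lt (μ : Measure ℂ) [IsProbabilityMeasure μ]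
    (hμ : μ ≪ volume) {M : ℕ} (hM : 0 < M) (I : Fin M → ℂ) {ψ : ℂ → ℝ} (hψ : MemLp ψ 2 μ)
    (A : ℝ) :
    ∃ δ > 0, Tendsto (fun N : ℕ => (Measure.pi fun _ : Fin N => μ)
      {r | ∃ g ∈ Metric.closedBall (0 : ℂ) A, ∃ s, 0 < s ∧ s < δ ∧
        ∑ n, ψ (r n) ≤ ∑ n, Real.log (gaussMix (fun m => g * I m) s (r n))}) atTop (𝓝 0) := by
  refine (isCompact_closedBall (0 : ℂ) A).induction_on (p := fun t => ∃ δ > 0,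
    Tendsto (fun N : ℕ => (Measure.pi fun _ : Fin N => μ) {r | ∃ g ∈ t, ∃ s, 0 < s ∧ s < δ ∧
      ∑ n, ψ (r n) ≤ ∑ n, Real.log (gaussMix (fun m => g * I m) s (r n))}) atTop (𝓝 0))
    ?_ ?_ ?_ ?_
  · exact ⟨1, one_pos, by simp⟩
  · rintro t t' htt' ⟨δ, hδ, h⟩
    refine ⟨δ, hδ, tendsto_measure_of_subset_union _ _ _ _
      (Eventually.of_forall fun N r hr => ?_) h h⟩
    obtain ⟨g, hg, h⟩ := hr
    exact Or.inl ⟨g, htt' hg, h⟩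
  · rintro t t' ⟨δ, hδ, h⟩ ⟨δ', hδ', h'⟩
    refine ⟨min δ δ', lt_min hδ hδ', tendsto_measure_of_subset_union _ _ _ _
      (Eventually.of_forall fun N r hr => ?_) h h'⟩
    obtain ⟨g, hg | hg, s, hs, hsδ, hle⟩ := hr
    · exact Or.inl ⟨g, hg, s, hs, hsδ.trans_le (min_le_left _ _), hle⟩
    · exact Or.inr ⟨g, hg, s, hs, hsδ.trans_le (min_le_right _ _), hle⟩
  · intro g₀ _
    set F : Set ℂ := Set.range fun m => g₀ * I m with hF
    have hFfin : F.Finite := Set.finite_range _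
    have hF0 : μ F = 0 := hμ (hFfin.measure_zero _)
    -- The centers form a closed null set, so some closed neighbourhood `V` of them has mass below
    -- `1 / 2`; by the law of large numbers fewer than half of the samples then fall in `V`.
    have hthick := tendsto_measure_cthickening_of_isClosed (μ := μ) (s := F)
      ⟨1, one_pos, measure_ne_top _ _⟩ hFfin.isClosed
    rw [hF0] at hthick
    have hev : ∀ᶠ ρ in 𝓝[>] (0 : ℝ), μ (Metric.cthickening ρ F) < ENNReal.ofReal (1 / 2) :=
      (hthick.mono_left nhdsWithin_le_nhds).eventually_lt_const (by simp)
    obtain ⟨ρ₂, hρ₂, hρ₂pos⟩ := (hev.and self_mem_nhdsWithin).exists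
    -- Half of `ρ₂` pays for moving the gain from `g₀` to a nearby `g`; the other half remains as
    -- the distance of samples outside `V` from the moved centers.
    set ρ := ρ₂ / 2 with hρ
    have hρ0 : 0 < ρ := half_pos hρ₂pos
    set V := Metric.cthickening ρ₂ F with hV
    have hVm : MeasurableSet V := Metric.isClosed_cthickening.measurableSet
    have hVr : μ.real V < 1 / 2 := by
      rw [Measure.real, ← ENNReal.toReal_ofReal (by norm_num : (0 : ℝ) ≤ 1 / 2)]
      exact (ENNReal.toReal_lt_toReal (measure_ne_top _ _) (by simp)).2 hρ₂
    set χ : ℂ → ℝ := V.indicator fun _ => 1 with hχ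
    have hχL : MemLp χ 2 μ := (memLp_const (1 : ℝ)).indicator hVm
    have hlln1 := tendsto_measure_sum_nonpos μ (φ := fun r => 1 / 2 - χ r)
      ((memLp_const (1 / 2 : ℝ)).sub hχL) (by
        rw [integral_sub (integrable_const _) (hχL.integrable (by norm_num)), hχ,
          integral_indicator_const _ hVm]
        simpa using hVr)
    set e := ∫ r, ψ r ∂μ with he
    have hlln2 := tendsto_measure_sum_nonpos μ (φ := fun r => ψ r - (e - 1))
      (hψ.sub (memLp_const (e - 1))) (by
        rw [integral_sub (hψ.integrable (by norm_num)) (integrable_const _), ← he]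
        simp)
    -- At least half of the samples incur the penalty `ρ ^ 2 / s`, hence `k = ρ ^ 2 / 2` per sample
    -- on average. The level `e - 1` lies below the mean of `ψ`, so the sum of `ψ` exceeds `N * (e -
    -- 1)` with high probability.
    obtain ⟨δ, hδ, hδs⟩ := exists_forall_neg_log_sub_lt (k := ρ ^ 2 / 2) (by positivity) (e - 1)
    set R : ℝ := 1 + ∑ m, ‖I m‖ with hR
    have hR0 : 0 < R := by positivity
    refine ⟨Metric.ball g₀ (ρ / R), mem_nhdsWithin_of_mem_nhds (Metric.ball_mem_nhds _
      (by positivity)), δ, hδ, ?_⟩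
    refine tendsto_measure_of_subset_union _ _ _ _ ?_ hlln1 hlln2
    filter_upwards [eventually_gt_atTop 0] with N hN r hr
    have hN' : (0 : ℝ) < N := by exact_mod_cast hN
    obtain ⟨g, hg, s, hs, hsδ, hle⟩ := hr
    by_contra hcon
    simp only [Set.mem_union, Set.mem_ofPred_eq, not_or, not_le] at hcon
    obtain ⟨hc1, hc2⟩ := hcon
    simp only [Finset.sum_sub_distrib, Finset.sum_const, Finset.card_univ, Fintype.card_fin,
      nsmul_eq_mul] at hc1 hc2
    have hpt : ∀ z : ℂ, Real.log (gaussMix (fun m => g * I m) s z) ≤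
        -Real.log (Real.pi * s) - ρ ^ 2 / s * (1 - χ z) := by
      intro z
      by_cases hz : z ∈ V
      · have := log_gaussMix_le (fun m => g * I m) z hM hs (x := 0) fun m => by positivity
        simpa [hχ, hz] using this
      · have := log_gaussMix_le (fun m => g * I m) z hM hs (x := ρ ^ 2) fun m => by
          have h1 : ρ₂ < ‖z - g₀ * I m‖ := by
            by_contra! hcl
            exact hz (Metric.mem_cthickening_of_dist_le z (g₀ * I m) ρ₂ F ⟨m, rfl⟩
              (by rwa [dist_eq_norm]))
          have h2 : ‖I m‖ ≤ R := by
            have := Finset.single_le_sum (f := fun m => ‖I m‖) (fun m _ => norm_nonneg _)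
              (Finset.mem_univ m)
            linarith
          have h3 : ‖(g - g₀) * I m‖ ≤ ρ := by
            rw [norm_mul]
            rw [Metric.mem_ball, dist_eq_norm] at hg
            calc ‖g - g₀‖ * ‖I m‖ ≤ ρ / R * R := by gcongr
              _ = ρ := by field_simp
          have h4 : ‖z - g₀ * I m‖ ≤ ‖z - g * I m‖ + ‖(g - g₀) * I m‖ := by
            have : z - g₀ * I m = (z - g * I m) + (g - g₀) * I m := by ring
            rw [this]
            exact norm_add_le _ _
          have h5 : ρ ≤ ‖z - g * I m‖ := by linarith
          gcongr
        simpa [hχ, hz] using this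
    have hsum := Finset.sum_le_sum fun (n : Fin N) (_ : n ∈ Finset.univ) => hpt (r n)
    rw [Finset.sum_sub_distrib, ← Finset.mul_sum, Finset.sum_sub_distrib] at hsum
    simp only [Finset.sum_const, Finset.card_univ, Fintype.card_fin, nsmul_eq_mul] at hsum
    have hk : ρ ^ 2 / s * (N / 2) ≤ ρ ^ 2 / s * (N * 1 - ∑ n, χ (r n)) := by
      gcongr
      linarith
    have h6 := mul_lt_mul_of_pos_left (hδs s hs hsδ) hN'
    have h7 : (N : ℝ) * (-Real.log (Real.pi * s) - ρ ^ 2 / 2 / s) =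
        N * -Real.log (Real.pi * s) - ρ ^ 2 / s * (N / 2) := by
      field_simp
    linarith

/-! ### Maximum likelihood estimates -/

section

variable {A B : ℝ} {H : Modulation} {u : Param}

lemma Modulation.order_pos (H : Modulation) : 0 < H.order :=
  lt_of_lt_of_le two_pos H.two_le_order

lemma noise_nonneg_of_mem_box (hu : u ∈ box A B H) : 0 ≤ u.noise := hu.2.1.1

lemma norm_gain_le_of_mem_box (hu : u ∈ box A B H) : ‖u.gain‖ ≤ A := by
  have h0 : 0 ≤ u.amp := hu.1.1
  have h1 : u.amp ≤ A := hu.1.2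
  unfold Param.gain
  rw [norm_mul, Complex.norm_exp_ofReal_mul_I, mul_one, Complex.norm_real,
    Real.norm_of_nonneg h0]
  exact h1

lemma amp_pos_and_noise_pos_of_mem_interior_box (hu : u ∈ interior (box A B H)) :
    0 < u.amp ∧ 0 < u.noise := by
  unfold box at hu
  rw [interior_prod_eq, interior_prod_eq, interior_Icc, interior_Icc] at hu
  exact ⟨hu.1.1, hu.2.1.1⟩

lemma gain_ne_zero (hu : 0 < u.amp) : u.gain ≠ 0 :=
  mul_ne_zero (by exact_mod_cast hu.ne') (Complex.exp_ne_zero _)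

variable {N : ℕ} {r : Fin N → ℂ}

lemma sampleLikelihood_pos (hu : 0 < u.noise) (z : ℂ) : 0 < sampleLikelihood H u z :=
  gaussMix_pos _ z H.order_pos hu

lemma likelihood_pos (hu : 0 < u.noise) : 0 < likelihood H u r :=
  Finset.prod_pos fun _ _ => sampleLikelihood_pos hu _

lemma likelihood_eq_zero (hN : 0 < N) (hu : u.noise = 0) : likelihood H u r = 0 := by
  refine Finset.prod_eq_zero (Finset.mem_univ ⟨0, hN⟩) ?_
  rw [sampleLikelihood_eq, hu, gaussMix_zero]

lemma log_likelihood (hu : 0 < u.noise) :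
    Real.log (likelihood H u r) = ∑ n, Real.log (sampleLikelihood H u (r n)) :=
  Real.log_prod fun _ _ => (sampleLikelihood_pos hu _).ne'

/-- On the face `N₀ = 0` the likelihood is zero, so a maximizer avoids it. This matters because
`Real.log 0 = 0` would make the sum of logarithms meaningless there. -/
lemma IsMLEstimator.noise_pos_and_sum_le {est : (Fin N → ℂ) → Param}
    (hest : IsMLEstimator A B H est) (hN : 0 < N)
    (hex : ∃ v ∈ box A B H, IsMaxOn (fun v => likelihood H v r) (box A B H) v)
    (hu : u ∈ box A B H) (hu0 : 0 < u.noise) :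
    0 < (est r).noise ∧ ∑ n, Real.log (sampleLikelihood H u (r n)) ≤
      ∑ n, Real.log (sampleLikelihood H (est r) (r n)) := by
  have hle : likelihood H u r ≤ likelihood H (est r) r := (hest r).2 hex hu
  have hpos : 0 < likelihood H u r := likelihood_pos hu0
  have hnoise : 0 < (est r).noise := by
    refine lt_of_le_of_ne (noise_nonneg_of_mem_box (hest r).1) fun h0 => ?_
    rw [likelihood_eq_zero hN h0.symm] at hle
    linarith
  refine ⟨hnoise, ?_⟩
  rw [← log_likelihood hu0, ← log_likelihood hnoise]
  exact Real.log_le_log hpos hle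

lemma continuousOn_likelihood {δ : ℝ} (hδ : 0 < δ) :
    ContinuousOn (fun v => likelihood H v r) {v : Param | δ ≤ v.noise} := by
  unfold likelihood sampleLikelihood Param.gain
  refine continuousOn_finsetProd _ fun n _ => continuousOn_const.mul
    (continuousOn_finsetSum _ fun m _ => ContinuousOn.mul ?_ ?_)
  · refine ContinuousOn.inv₀ (by fun_prop) fun v hv => ?_
    have : 0 < v.noise := hδ.trans_le hv
    positivity
  · refine Real.continuous_exp.comp_continuousOn (ContinuousOn.neg
      (ContinuousOn.div (by fun_prop) (by fun_prop) fun v hv => ?_))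
    exact (hδ.trans_le hv).ne'

/-- The likelihood attains its maximum if it is small for small noise powers. -/
lemma exists_isMaxOn_likelihood (hN : 0 < N) {δ : ℝ} (hδ : 0 < δ) (hu : u ∈ box A B H)
    (hu0 : 0 < u.noise)
    (hsmall : ∀ v ∈ box A B H, 0 < v.noise → v.noise < δ →
      ∑ n, Real.log (sampleLikelihood H v (r n)) < ∑ n, Real.log (sampleLikelihood H u (r n))) :
    ∃ v ∈ box A B H, IsMaxOn (fun v => likelihood H v r) (box A B H) v := by
  have hbox : IsCompact (box A B H) := isCompact_Icc.prod (isCompact_Icc.prod isCompact_Icc)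
  have hcl : IsClosed {v : Param | δ ≤ v.noise} := isClosed_le continuous_const (by fun_prop)
  have huδ : δ ≤ u.noise := by
    by_contra! h
    exact lt_irrefl _ (hsmall u hu hu0 h)
  -- Continuity may fail at `N₀ = 0`, so the maximum is taken over the part of the box with `N₀ ≥
  -- δ`. That part contains `u`, and every point outside it does no better than `u`.
  obtain ⟨w, hw, hmax⟩ := (hbox.inter_right hcl).exists_isMaxOn ⟨u, hu, huδ⟩
    ((continuousOn_likelihood (H := H) (r := r) hδ).mono Set.inter_subset_right)
  refine ⟨w, hw.1, fun v hv => ?_⟩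
  change likelihood H v r ≤ likelihood H w r
  rcases le_or_gt δ v.noise with hvδ | hvδ
  · exact hmax ⟨hv, hvδ⟩
  refine le_trans ?_ (hmax (show u ∈ _ from ⟨hu, huδ⟩))
  rcases (noise_nonneg_of_mem_box hv).eq_or_lt with hv0 | hv0
  · rw [likelihood_eq_zero hN hv0.symm]
    exact (likelihood_pos hu0).le
  · rw [← Real.log_le_log_iff (likelihood_pos hv0) (likelihood_pos hu0), log_likelihood hv0,
      log_likelihood hu0]
    exact (hsmall v hv hv0 hvδ).le

end

/-! ### Consistency -/

section

variable {A B : ℝ} {M : ℕ} (c : Fin M → ℂ) {s : ℝ}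

lemma mixLaw_absolutelyContinuous (hM : 0 < M) (hs : 0 < s) : mixLaw c s ≪ volume := by
  rw [mixLaw_eq_withDensity c hM hs]
  exact withDensity_absolutelyContinuous _ _

/-- A maximum likelihood estimate exists with probability tending to one. -/
lemma tendsto_measure_not_exists_isMaxOn (hM : 0 < M) (hs : 0 < s) (H : Modulation) {u : Param}
    (hu : u ∈ box A B H) (hu0 : 0 < u.noise) :
    Tendsto (fun N : ℕ => (Measure.pi fun _ : Fin N => mixLaw c s)
      {r | ¬ ∃ v ∈ box A B H, IsMaxOn (fun v => likelihood H v r) (box A B H) v})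
      atTop (𝓝 0) := by
  have := isProbabilityMeasure_mixLaw c hM s
  -- Here `ψ` is the log-likelihood at the reference point `u` of the box. The sampling law need not
  -- belong to `H`, so true and wrong formats are both covered.
  obtain ⟨δ, hδ, h⟩ := exists_tendsto_measure_exists_le_of_variance_lt (mixLaw c s)
    (mixLaw_absolutelyContinuous c hM hs) H.order_pos H.symbol
    (memLp_two_log_gaussMix c (fun m => u.gain * H.symbol m) hM H.order_pos hu0 (s := s)) A
  refine tendsto_measure_of_subset_union _ _ _ _ ?_ h h
  filter_upwards [eventually_gt_atTop 0] with N hN r hr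
  left
  by_contra hcon
  refine hr (exists_isMaxOn_likelihood hN hδ hu hu0 fun v hv hv0 hvδ => ?_)
  by_contra! hle
  exact hcon ⟨v.gain, by simpa using norm_gain_le_of_mem_box hv, v.noise, hv0, hvδ, hle⟩

/-- If no member of the family of `H` is the true density, then with probability tending to one
all members have smaller likelihood than the true density. -/
lemma tendsto_measure_exists_le (hM : 0 < M) (hs : 0 < s) (H : Modulation)
    (hne : ∀ g t, 0 < t → ∃ r, gaussMix c s r ≠ gaussMix (fun m => g * H.symbol m) t r) :
    Tendsto (fun N : ℕ => (Measure.pi fun _ : Fin N => mixLaw c s)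
      {r | ∃ v ∈ box A B H, 0 < v.noise ∧ ∑ n, Real.log (gaussMix c s (r n)) ≤
        ∑ n, Real.log (sampleLikelihood H v (r n))}) atTop (𝓝 0) := by
  have := isProbabilityMeasure_mixLaw c hM s
  have hψ := memLp_two_log_gaussMix c c hM hM hs (s := s)
  obtain ⟨δ, hδ, h⟩ := exists_tendsto_measure_exists_le_of_variance_lt (mixLaw c s)
    (mixLaw_absolutelyContinuous c hM hs) H.order_pos H.symbol hψ A
  have hquad : MemLp (fun r : ℂ => 1 + ‖r‖ ^ 2) 2 (mixLaw c s) :=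
    memLp_two_mixLaw c hM s (by fun_prop) (C := 1) fun r => by
      rw [one_mul, abs_of_nonneg (by positivity)]
  -- The remaining parameters are covered by the compact set of gains of modulus at most `A` and
  -- noise powers in `[δ, B]`.
  have h' := tendsto_measure_exists_le_of_isCompact (mixLaw c s) hquad H.order_pos H.symbol
    (fun g t ht => memLp_two_log_gaussMix c _ hM H.order_pos ht) hψ
    ((isCompact_closedBall (0 : ℂ) A).prod (isCompact_Icc (a := δ) (b := B)))
    (fun p hp => hδ.trans_le hp.2.1)
    (fun p hp => integral_log_gaussMix_sub_pos c _ hM H.order_pos hs (hδ.trans_le hp.2.1)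
      (hne p.1 p.2 (hδ.trans_le hp.2.1)))
  refine tendsto_measure_of_subset_union _ _ _ _ (Eventually.of_forall fun N r hr => ?_) h h'
  obtain ⟨v, hv, hv0, hle⟩ := hr
  have hg : v.gain ∈ Metric.closedBall (0 : ℂ) A := by simpa using norm_gain_le_of_mem_box hv
  rcases lt_or_ge v.noise δ with hvδ | hvδ
  · exact Or.inl ⟨v.gain, hg, v.noise, hv0, hvδ, hle⟩
  · exact Or.inr ⟨(v.gain, v.noise), ⟨hg, hvδ, hv.2.1.2⟩, hle⟩

end

lemma testStat_lt_testStat {H H' : Modulation} {u v : Param} {N : ℕ} {r : Fin N → ℂ} (hN : 0 < N)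
    (h : ∑ n, Real.log (sampleLikelihood H' v (r n)) <
      ∑ n, Real.log (sampleLikelihood H u (r n))) :
    testStat H u r < testStat H' v r := by
  have hN' : (0 : ℝ) < N := by exact_mod_cast hN
  unfold testStat
  exact mul_lt_mul_of_neg_left h (neg_neg_of_pos (by positivity))

/-- A wrong format beats the true one with probability tending to zero. -/
lemma tendsto_measure_not_testStat_lt {A B : ℝ} {H H' : Modulation}
    (hne : (H.family, H.order) ≠ (H'.family, H'.order)) {u u' : Param}
    (hu : u ∈ interior (box A B H)) (hu' : u' ∈ interior (box A B H'))
    {est est' : (N : ℕ) → (Fin N → ℂ) → Param} (hest : ∀ N, IsMLEstimator A B H (est N))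
    (hest' : ∀ N, IsMLEstimator A B H' (est' N)) :
    Tendsto (fun N : ℕ => observationLaw H u N
      {r | ¬ testStat H (est N r) r < testStat H' (est' N r) r}) atTop (𝓝 0) := by
  obtain ⟨ha, hs⟩ := amp_pos_and_noise_pos_of_mem_interior_box hu
  obtain ⟨-, hs'⟩ := amp_pos_and_noise_pos_of_mem_interior_box hu'
  simp only [observationLaw_eq_pi H H.order_pos]
  set c : Fin H.order → ℂ := fun m => u.gain * H.symbol m
  have h1 := tendsto_measure_not_exists_isMaxOn c H.order_pos hs H (interior_subset hu) hs
  -- For the wrong format, `u'` serves only as a point of its box with positive noise power.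
  have h2 := tendsto_measure_not_exists_isMaxOn c H.order_pos hs H' (interior_subset hu') hs'
  have h3 := tendsto_measure_exists_le (A := A) (B := B) c H.order_pos hs H'
    fun g t ht => exists_gaussMix_ne hne (gain_ne_zero ha) hs ht
  refine tendsto_measure_of_subset_union _ _ _ _ ?_ h1
    (tendsto_measure_of_subset_union _ _ _ _ (Eventually.of_forall fun _ => subset_rfl) h2 h3)
  filter_upwards [eventually_gt_atTop 0] with N hN r hr
  by_contra hcon
  simp only [Set.mem_union, not_or] at hcon
  obtain ⟨hc1, hc2, hc3⟩ := hcon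
  have hle := ((hest N).noise_pos_and_sum_le hN (not_not.1 hc1) (interior_subset hu) hs).2
  have hpos := ((hest' N).noise_pos_and_sum_le hN (not_not.1 hc2) (interior_subset hu') hs').1
  -- The true parameter is the intermediate term: strictly better than the wrong estimate, and no
  -- better than the estimate for the true format.
  refine hr (testStat_lt_testStat hN (lt_of_lt_of_le ?_ hle))
  by_contra! hge
  exact hc3 ⟨est' N r, (hest' N r).1, hpos, hge⟩

end HLRT

/-- The HLRT classifier with maximum likelihood estimates of amplitude, noise power and phase has
asymptotically vanishing probability of error, whatever the true parameters are. -/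
theorem theorem2 (S : ℕ) (H : Fin S → HLRT.Modulation)
    (hH : Function.Injective fun i => ((H i).family, (H i).order))
    (A B : ℝ) (u : Fin S → HLRT.Param) (hu : ∀ i, u i ∈ interior (HLRT.box A B (H i)))
    (est : (N : ℕ) → Fin S → (Fin N → ℂ) → HLRT.Param)
    (hest : ∀ N i, HLRT.IsMLEstimator A B (H i) (est N i)) :
    Tendsto (fun N : ℕ => HLRT.avgErrorProb H (est N) u) atTop (𝓝 0) := by
  have herr : ∀ i, Tendsto (fun N : ℕ => HLRT.errorProb H (est N) i (u i)) atTop (𝓝 0) := by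
    intro i
    let E : Fin S → (N : ℕ) → Set (Fin N → ℂ) := fun j N => {r | ¬ HLRT.testStat (H i)
      (est N i r) r < HLRT.testStat (H j) (est N j r) r}
    have hsum : Tendsto (fun N : ℕ => ∑ j ∈ Finset.univ.erase i,
        HLRT.observationLaw (H i) (u i) N (E j N)) atTop (𝓝 0) := by
      have := tendsto_finsetSum (Finset.univ.erase i) fun j hj =>
        HLRT.tendsto_measure_not_testStat_lt (A := A) (B := B)
          (fun h => (Finset.ne_of_mem_erase hj) (hH h).symm) (hu i) (hu j)
          (fun N => hest N i) (fun N => hest N j)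
      rwa [Finset.sum_const_zero] at this
    have hE : Tendsto (fun N : ℕ => HLRT.observationLaw (H i) (u i) N
        {r | ¬ ∀ j, j ≠ i → HLRT.testStat (H i) (est N i r) r <
          HLRT.testStat (H j) (est N j r) r}) atTop (𝓝 0) := by
      -- Union bound over the finitely many competitors `j ≠ i`.
      refine tendsto_of_tendsto_of_tendsto_of_le_of_le tendsto_const_nhds hsum
        (fun _ => zero_le) fun N => ?_
      refine (measure_mono fun r hr => ?_).trans (measure_biUnion_finset_le _ _)
      obtain ⟨j, hj⟩ := not_forall.1 hr
      obtain ⟨hji, hlt⟩ := Classical.not_imp.1 hj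
      exact Set.mem_biUnion (by simpa using hji) hlt
    exact (ENNReal.tendsto_toReal ENNReal.zero_ne_top).comp hE
  have hlim := (tendsto_finsetSum Finset.univ fun i _ => herr i).const_mul (1 / (S : ℝ))
  rwa [Finset.sum_const_zero, mul_zero] at hlim
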